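/- Let $\mathbb{R}_e=\mathbb{R}\cup\{-\infty\}$ with the max-plus operations $x\oplus y=\max\{x,y\}$ and $x\otimes y=x+y$; matrix and vector products and powers below are max-plus, so $(Ax)_i=\max_j(a_{ij}+x_j)$, and $\lambda^d x$ is the vector with entries $d\lambda+x_i$. A matrix $A=(a_{ij})\in\mathbb{R}_e^{n\times n}$ is irreducible if for all $i,j$ there are $q\ge 1$ and indices $i=i_0,i_1,\dots,i_q=j$ with $a_{i_0i_1}+a_{i_1i_2}+\dots+a_{i_{q-1}i_q}>-\infty$. **Theorem 4.** Let $m\ge1$ and let $A_1,\dots,A_m\in\mathbb{R}_e^{n\times n}$ be irreducible matrices with all main diagonal entries different from $-\infty$. Let $0\le k_1<k_2<\dots<k_m$ be integers and $K=k_m+1$. Consider the switched system $X(k+1)=A_{i(k)}X(k)$, $k\ge 0$, where $i(k)=1$ if $k \bmod K\in\{0,\dots,k_1\}$, and $i(k)=i$ if $k\bmod K\in\{k_{i-1}+1,\dots,k_i\}$ for $2\le i\le m$. Then there exist a real number $\lambda$ and positive integers $d$ and $k_0$ such that, for every initial state $X(0)\in\mathbb{R}_e^n$, $$X(k+d)=\lambda^d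 X(k)\qquad\text{for all } k\ge k_0 .$$ Moreover, $\lambda$ can be taken positive if all diagonal entries of $A_1,\dots,A_m$ are positive. -/

import Mathlib

namespace MaxPlus

/-- The extended reals `ℝ ∪ {-∞}` of max-plus algebra: the null element `ε = -∞` is `⊥`,
`x ⊕ y` is `x ⊔ y`, and `x ⊗ y` is `x + y` (with `⊥ + x = ⊥`). -/
abbrev Re : Type := WithBot ℝ

/-- Irreducibility: between any two indices `i`, `j` (equal or not) there is a path
`i = p 0, p 1, …, p q = j` with at least one step whose total weight is not `-∞`. -/
def Irred {n : ℕ} (A : Matrix (Fin n) (Fin n) Re) : Prop :=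
  ∀ i j : Fin n, ∃ (q : ℕ) (p : Fin (q + 1) → Fin n), 0 < q ∧ p 0 = i ∧ p (Fin.last q) = j ∧
    (⊥ : Re) < ∑ s : Fin q, A (p s.castSucc) (p s.succ)

/-- The max-plus product of a matrix and a column vector: `(A x)_i = max_j (a_ij + x_j)`. -/
def mulVec {n : ℕ} (A : Matrix (Fin n) (Fin n) Re) (x : Fin n → Re) : Fin n → Re :=
  fun i => Finset.univ.sup fun j => A i j + x j

/-- The max-plus product of a scalar and a column vector: `(c x)_i = c + x_i`. -/
def scale {n : ℕ} (c : Re) (x : Fin n → Re) : Fin n → Re :=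
  fun i => c + x i

/-- The max-plus power `c ⊗ ⋯ ⊗ c` (`d` factors), which is the `d`-fold sum of `c`. -/
def pow (c : Re) (d : ℕ) : Re := d • c

/-- The period `K = k_m + 1` of the switching law with block ends `k_1 < k_2 < ⋯ < k_m`. -/
def period {m : ℕ} [NeZero m] (k : Fin m → ℕ) : ℕ :=
  k ⟨m - 1, Nat.sub_one_lt (NeZero.ne m)⟩ + 1

/-- Mode `i` is active at time `t`: the residue `t mod K` lies in the `i`-th block, that is, it is
at most the block end `k i` and exceeds the block ends of all the earlier modes. -/
def Active {m : ℕ} [NeZero m] (k : Fin m → ℕ) (t : ℕ) (i : Fin m) : Prop :=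
  (∀ j < i, k j < t % period k) ∧ t % period k ≤ k i

/-- At every time exactly one mode is active. -/
theorem existsUnique_active {m : ℕ} [NeZero m] (k : Fin m → ℕ) (t : ℕ) :
    ∃! i, Active k t i := by
  have hne : {i : Fin m | t % period k ≤ k i}.Nonempty :=
    ⟨⟨m - 1, Nat.sub_one_lt (NeZero.ne m)⟩,
      Nat.lt_succ_iff.mp (Nat.mod_lt t (Nat.succ_pos _))⟩
  obtain ⟨i₀, h₀, hmin⟩ := wellFounded_lt.has_min _ hne
  refine ⟨i₀, ⟨fun j hj => ?_, h₀⟩, fun i hi => ?_⟩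
  · by_contra h
    exact hmin j (not_lt.mp h) hj
  · rcases lt_trichotomy i i₀ with h | h | h
    · exact absurd h (hmin i hi.2)
    · exact h
    · exact absurd (hi.1 _ h) (not_lt.mpr h₀)

/-- `X` is a trajectory of the switched system: `X(t+1) = A_i X(t)`, where `i` is the mode
active at time `t`; the initial state `X 0` is arbitrary. -/
def IsTrajectory {m n : ℕ} [NeZero m] (A : Fin m → Matrix (Fin n) (Fin n) Re) (k : Fin m → ℕ)
    (X : ℕ → Fin n → Re) : Prop :=
  ∀ (t : ℕ) (i : Fin m), Active k t i → X (t + 1) = mulVec (A i) (X t)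

end MaxPlus

namespace MaxPlus

/-! Over one period K the system acts by B = `prodMat D K`. Combining an edge of `D 0` with loops of
the later factors shows that B has finite diagonal and is strongly connected, so its orbits are
eventually periodic up to scaling (`exists_orbit_periodic`); max-plus linearity carries this to
times between multiples of K.

The cyclicity behind this (`exists_cyclicity`) concerns weights of walks. Let μ be the maximal cycle
mean, C the set of vertices on closed walks of mean μ, and c a common multiple of the lengths of
such walks, one per vertex of C. Walks avoiding C grow at a rate below μ, so long ones are beaten by
walks meeting C. The latter gain c steps and weight μc by inserting critical cycles
(`Through.extend`), and lose c steps at a cost of at most μc (`Through.shorten`). -/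

/-- `Walk A t i j w`: there is a walk of length `t` from `i` to `j` of total weight `w` in the
weighted digraph of `A`, whose edges are the entries different from `-∞`. -/
inductive Walk {V : Type*} (A : V → V → Re) : ℕ → V → V → ℝ → Prop
  | nil (i : V) : Walk A 0 i i 0
  | cons {t : ℕ} {i k j : V} {a w : ℝ} (h : A i k = (a : Re)) (p : Walk A t k j w) :
      Walk A (t + 1) i j (a + w)

/-! ### Walks and cycle means -/

namespace Walk

variable {V : Type*} {A : V → V → Re}

theorem of_eq {t t' : ℕ} {i j : V} {w w' : ℝ} (h : Walk A t i j w) (ht : t = t') (hw : w = w') :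
    Walk A t' i j w' := ht ▸ hw ▸ h

theorem single {i j : V} {a : ℝ} (h : A i j = (a : Re)) : Walk A 1 i j a :=
  (cons h (nil j)).of_eq rfl (add_zero a)

theorem append {s t : ℕ} {i j k : V} {u w : ℝ} (p : Walk A s i j u) (q : Walk A t j k w) :
    Walk A (s + t) i k (u + w) := by
  induction p with
  | nil i => exact q.of_eq (by omega) (by ring)
  | cons h p ih => exact (cons h (ih q)).of_eq (by omega) (by ring)

theorem repeat_closed {l : ℕ} {v : V} {w : ℝ} (p : Walk A l v v w) (s : ℕ) :
    Walk A (s * l) v v (s * w) := by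
  induction s with
  | zero => exact (nil v).of_eq (by simp) (by simp)
  | succ s ih => exact (ih.append p).of_eq (by ring) (by push_cast; ring)

theorem weight_eq_zero {i j : V} {w : ℝ} (p : Walk A 0 i j w) : w = 0 := by
  cases p; rfl

/-- A walk given by its vertices and its partial weights. -/
theorem exists_positions {t : ℕ} {i j : V} {w : ℝ} (p : Walk A t i j w) :
    ∃ (v : ℕ → V) (u : ℕ → ℝ), v 0 = i ∧ v t = j ∧ u 0 = 0 ∧ u t = w ∧
      ∀ a b, a ≤ b → b ≤ t → Walk A (b - a) (v a) (v b) (u b - u a) := by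
  induction p with
  | nil i =>
    refine ⟨fun _ => i, fun _ => 0, rfl, rfl, rfl, rfl, fun a b hab hb => ?_⟩
    exact (nil i).of_eq (by omega) (by simp)
  | @cons t i k j a w h p ih =>
    obtain ⟨v, u, hv0, hvt, hu0, hut, hvu⟩ := ih
    refine ⟨fun | 0 => i | s + 1 => v s, fun | 0 => 0 | s + 1 => a + u s,
      rfl, hvt, rfl, by simp [hut], ?_⟩
    rintro (_ | x) (_ | y) hxy hy
    · exact (nil i).of_eq (by simp) (by simp)
    · have q := hvu 0 y (by omega) (by omega)
      rw [hv0] at q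
      exact (cons h q).of_eq (by omega) (by simp [hu0])
    · omega
    · exact (hvu x y (by omega) (by omega)).of_eq (by omega) (by ring)

/-- A long walk contains a closed walk whose length is a positive multiple of `c`. -/
theorem exists_closed_segment [Fintype V] {t c : ℕ} {i j : V} {w : ℝ} (p : Walk A t i j w)
    (hc : 0 < c) (ht : Fintype.card V * c ≤ t) :
    ∃ (v : V) (a l b : ℕ) (x y z : ℝ), Walk A a i v x ∧ Walk A l v v y ∧ Walk A b v j z ∧
      0 < l ∧ c ∣ l ∧ l ≤ Fintype.card V * c ∧ a + l + b = t ∧ x + y + z = w := by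
  classical
  obtain ⟨v, u, hv0, hvt, hu0, hut, hvu⟩ := p.exists_positions
  -- Pigeonhole on (vertex, position mod c) over the first `card V * c + 1` positions.
  have key : ∃ r s, r < s ∧ s ≤ Fintype.card V * c ∧ v r = v s ∧ r % c = s % c := by
    obtain ⟨r, hr, s, hs, hne, h⟩ := Finset.exists_ne_map_eq_of_card_lt_of_maps_to
      (s := Finset.range (Fintype.card V * c + 1))
      (t := (Finset.univ : Finset V) ×ˢ Finset.range c) (f := fun s => (v s, s % c))
      (by simp) (fun s _ => by simp [Nat.mod_lt _ hc])
    simp only [Prod.mk.injEq, Finset.mem_range] at h hr hs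
    rcases lt_or_gt_of_ne hne with h' | h'
    · exact ⟨r, s, h', by omega, h.1, h.2⟩
    · exact ⟨s, r, h', by omega, h.1.symm, h.2.symm⟩
  obtain ⟨r, s, hrs, hs, hv, hmod⟩ := key
  have h1 := hvu 0 r (by omega) (by omega)
  have h2 := hvu r s (by omega) (by omega)
  have h3 := hvu s t (by omega) le_rfl
  rw [hv0, hv] at h1
  rw [hv] at h2
  rw [hvt] at h3
  exact ⟨v s, _, _, _, _, _, _, h1, h2, h3, by omega, (Nat.modEq_iff_dvd' hrs.le).1 hmod,
    by omega, by omega, by rw [hu0, hut]; ring⟩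

/-- The endpoints of an edge determine its weight. Finiteness gives the bounds and maxima over short
walks. -/
theorem finite_setOf [Finite V] (A : V → V → Re) (t : ℕ) :
    {q : V × V × ℝ | Walk A t q.1 q.2.1 q.2.2}.Finite := by
  induction t with
  | zero =>
    refine (Set.finite_range fun i : V => (i, i, (0 : ℝ))).subset ?_
    rintro ⟨i, j, w⟩ h
    cases h
    exact ⟨i, rfl⟩
  | succ t ih =>
    refine (((Set.finite_univ (α := V)).prod ih).image fun q =>
      (q.1, q.2.2.1, (A q.1 q.2.1).unbotD 0 + q.2.2.2)).subset ?_
    rintro ⟨i, j, w⟩ h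
    cases h with
    | @cons _ _ k _ a w h p => exact ⟨(i, k, j, w), ⟨trivial, p⟩, by simp only [h, WithBot.unbotD_coe]; rfl⟩

/-- If every closed walk has mean weight at most `μ`, then walks grow at rate at most `μ`. -/
theorem exists_weight_le [Fintype V] {μ : ℝ} (hμ : ∀ i l w, Walk A l i i w → w ≤ μ * l) :
    ∃ M : ℝ, ∀ t i j w, Walk A t i j w → w ≤ M + μ * t := by
  have hfin : (⋃ t ∈ Finset.range (Fintype.card V),
      (fun q : V × V × ℝ => q.2.2 - μ * t) ''
        {q : V × V × ℝ | Walk A t q.1 q.2.1 q.2.2}).Finite :=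
    Set.Finite.biUnion (Finset.finite_toSet _) fun t _ => (finite_setOf A t).image _
  obtain ⟨M, hM⟩ := hfin.bddAbove
  refine ⟨M, fun t => ?_⟩
  induction t using Nat.strong_induction_on with
  | _ t ih =>
    intro i j w p
    rcases lt_or_ge t (Fintype.card V) with ht | ht
    · have := hM (Set.mem_biUnion (x := t) (by simpa using ht) ⟨(i, j, w), p, rfl⟩)
      simp only at this
      linarith
    · obtain ⟨v, a, l, b, x, y, z, h1, h2, h3, hl, -, -, hsum, hw⟩ :=
        p.exists_closed_segment one_pos (by simpa using ht)
      have e1 := ih (a + b) (by omega) _ _ _ (h1.append h3)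
      have e2 := hμ _ _ _ h2
      rw [← hsum]
      push_cast at e1 ⊢
      linarith

/-- The maximal cycle mean is attained. -/
theorem exists_max_mean [Fintype V] (hex : ∃ i l w, 0 < l ∧ Walk A l i i w) :
    ∃ μ : ℝ, (∃ i l, 0 < l ∧ Walk A l i i (μ * l)) ∧ ∀ i l w, Walk A l i i w → w ≤ μ * l := by
  -- Lengths up to `card V` suffice: a longer closed walk splits into two shorter closed ones.
  set T : Set ℝ := ⋃ l ∈ Finset.Icc 1 (Fintype.card V), (fun q : V × V × ℝ => q.2.2 / l) ''
    {q : V × V × ℝ | Walk A l q.1 q.2.1 q.2.2 ∧ q.1 = q.2.1} with hT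
  have hfin : T.Finite := Set.Finite.biUnion (Finset.finite_toSet _) fun l _ =>
    ((finite_setOf A l).subset fun q hq => hq.1).image _
  have hmem : ∀ i l w, 0 < l → l ≤ Fintype.card V → Walk A l i i w → w / l ∈ T :=
    fun i l w h0 h1 p => Set.mem_biUnion (x := l) (by simp; omega) ⟨(i, i, w), ⟨p, rfl⟩, rfl⟩
  have hne : T.Nonempty := by
    obtain ⟨i, l, w, hl, p⟩ := hex
    rcases le_total l (Fintype.card V) with h | h
    · exact ⟨_, hmem _ _ _ hl h p⟩
    · obtain ⟨v, a, l, b, x, y, z, -, h2, -, hl, -, hl', -⟩ :=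
        p.exists_closed_segment one_pos (by simpa using h)
      exact ⟨_, hmem _ _ _ hl (by simpa using hl') h2⟩
  obtain ⟨μ, hμT, hμ⟩ := Set.exists_max_image T id hfin hne
  refine ⟨μ, ?_, fun i l => ?_⟩
  · simp only [hT, Set.mem_iUnion] at hμT
    obtain ⟨l, hl, ⟨i, j, w⟩, ⟨p, hij⟩, rfl⟩ := hμT
    simp only at p hij
    subst hij
    have : 1 ≤ l := (Finset.mem_Icc.1 hl).1
    have h0 : (l : ℝ) ≠ 0 := by positivity
    exact ⟨i, l, this, p.of_eq rfl (by field_simp)⟩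
  · induction l using Nat.strong_induction_on generalizing i with
    | _ l ih =>
      intro w p
      rcases Nat.eq_zero_or_pos l with rfl | hl
      · simp [p.weight_eq_zero]
      rcases le_or_gt l (Fintype.card V) with h | h
      · have := hμ _ (hmem _ _ _ hl h p)
        have h0 : (0 : ℝ) < l := by positivity
        exact (div_le_iff₀ h0).1 this
      · obtain ⟨v, a, l', b, x, y, z, h1, h2, h3, hl0, -, hl', hsum, hw⟩ :=
          p.exists_closed_segment one_pos (by simpa using h.le)
        have e1 := ih (a + b) (by omega) _ _ (h1.append h3)
        have e2 := ih l' (by omega) _ _ h2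
        rw [← hsum]
        push_cast at e1 ⊢
        linarith

theorem mono {B : V → V → Re} (h : ∀ i j, A i j = ⊥ ∨ A i j = B i j) {t : ℕ} {i j : V} {w : ℝ}
    (p : Walk A t i j w) : Walk B t i j w := by
  induction p with
  | nil i => exact nil i
  | @cons t i k j a w e p ih =>
    exact cons (((h i k).resolve_left (by simp [e])).symm.trans e) ih

/-! ### Critical vertices and cyclicity -/

/-- A walk that visits a vertex of `C`. -/
def Through (A : V → V → Re) (C : Set V) (t : ℕ) (i j : V) (w : ℝ) : Prop :=
  ∃ v ∈ C, ∃ (a b : ℕ) (x y : ℝ), Walk A a i v x ∧ Walk A b v j y ∧ a + b = t ∧ x + y = w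

theorem Through.walk {C : Set V} {t : ℕ} {i j : V} {w : ℝ} (h : Through A C t i j w) :
    Walk A t i j w := by
  obtain ⟨v, -, a, b, x, y, p, q, rfl, rfl⟩ := h
  exact p.append q

open Classical in
/-- The digraph of `A` with the vertices of `C` isolated. -/
noncomputable def avoid (A : V → V → Re) (C : Set V) : V → V → Re :=
  fun i j => if i ∈ C ∨ j ∈ C then ⊥ else A i j

theorem of_avoid {C : Set V} {t : ℕ} {i j : V} {w : ℝ} (p : Walk (avoid A C) t i j w) :
    Walk A t i j w := by
  refine p.mono fun i j => ?_
  by_cases h : i ∈ C ∨ j ∈ C <;> simp [avoid, h]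

/-- The empty walk at a vertex of `C` survives isolation, hence `0 < t`. -/
theorem notMem_of_avoid {C : Set V} {t : ℕ} {i j : V} {w : ℝ} (p : Walk (avoid A C) t i j w)
    (ht : 0 < t) : i ∉ C := by
  cases p with
  | nil => omega
  | cons h p =>
    intro hi
    simp [avoid, hi] at h

theorem through_or_avoid (C : Set V) {t : ℕ} {i j : V} {w : ℝ} (p : Walk A t i j w) :
    Through A C t i j w ∨ Walk (avoid A C) t i j w := by
  induction p with
  | nil i => exact Or.inr (nil i)
  | @cons t i k j a w e p ih =>
    by_cases hi : i ∈ C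
    · exact Or.inl ⟨i, hi, 0, t + 1, 0, a + w, nil i, cons e p, by omega, by ring⟩
    by_cases hk : k ∈ C
    · exact Or.inl ⟨k, hk, 1, t, a, w, single e, p, by omega, rfl⟩
    rcases ih with ⟨v, hv, r, s, x, y, p₁, p₂, rfl, rfl⟩ | ih
    · exact Or.inl ⟨v, hv, r + 1, s, a + x, y, cons e p₁, p₂, by omega, by ring⟩
    · exact Or.inr (cons (by simp [avoid, hi, hk, e]) ih)

/-- In a digraph with a loop at every vertex, walks can be prolonged. -/
theorem exists_prolong (hdiag : ∀ i, A i i ≠ ⊥) {t : ℕ} {i j : V} {w : ℝ}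
    (p : Walk A t i j w) (s : ℕ) : ∃ w', Walk A (t + s) i j w' := by
  obtain ⟨a, ha⟩ := WithBot.ne_bot_iff_exists.1 (hdiag j)
  exact ⟨_, (p.append ((single ha.symm).repeat_closed s)).of_eq (by ring) rfl⟩

theorem exists_of_reflTransGen {i j : V} (h : Relation.ReflTransGen (fun i j => A i j ≠ ⊥) i j) :
    ∃ t w, Walk A t i j w := by
  induction h with
  | refl => exact ⟨0, 0, nil i⟩
  | tail _ h ih =>
    obtain ⟨t, w, p⟩ := ih
    obtain ⟨a, ha⟩ := WithBot.ne_bot_iff_exists.1 h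
    exact ⟨_, _, p.append (single ha.symm)⟩

section Critical

variable {μ : ℝ} {C : Set V} {c : ℕ} {t : ℕ} {i j : V} {w : ℝ}

theorem Through.extend (hcyc : ∀ v ∈ C, Walk A c v v (μ * c)) (h : Through A C t i j w) (s : ℕ) :
    Through A C (t + s * c) i j (w + μ * (s * c : ℕ)) := by
  obtain ⟨v, hv, a, b, x, y, p, q, rfl, rfl⟩ := h
  exact ⟨v, hv, _, b, _, y, p.append ((hcyc v hv).repeat_closed s), q, by ring,
    by push_cast; ring⟩

/-- One side of the visit to `C` is long, so it contains a closed segment of length (s + 1)c and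
mean at most μ. Cut it out, then put back s critical cycles of length c. -/
theorem Through.shorten [Fintype V] (hc : 0 < c) (hcyc : ∀ v ∈ C, Walk A c v v (μ * c))
    (hμ : ∀ i l w, Walk A l i i w → w ≤ μ * l) (h : Through A C (t + c) i j w)
    (ht : 2 * (Fintype.card V * c) ≤ t + c) :
    ∃ w', w ≤ w' + μ * c ∧ Through A C t i j w' := by
  have key : ∃ s w', w ≤ w' + μ * ((s + 1) * c : ℕ) ∧ (s + 1) * c ≤ t + c ∧
      Through A C (t + c - (s + 1) * c) i j w' := by
    obtain ⟨v, hv, a, b, x, y, p, q, hab, rfl⟩ := h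
    rcases le_or_gt (Fintype.card V * c) a with ha | ha
    · obtain ⟨u, a', l, b', x', y', z', h1, h2, h3, hl, ⟨s, rfl⟩, -, hsum, rfl⟩ :=
        p.exists_closed_segment hc ha
      obtain ⟨s, rfl⟩ : ∃ r, s = r + 1 := Nat.exists_eq_succ_of_ne_zero (by rintro rfl; simp at hl)
      have := hμ _ _ _ h2
      rw [mul_comm c] at this hsum
      exact ⟨s, x' + z' + y, by linarith, by omega, v, hv, _, b, _, y, h1.append h3, q,
        by omega, by ring⟩
    · obtain ⟨u, a', l, b', x', y', z', h1, h2, h3, hl, ⟨s, rfl⟩, -, hsum, rfl⟩ :=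
        q.exists_closed_segment hc (by omega)
      obtain ⟨s, rfl⟩ : ∃ r, s = r + 1 := Nat.exists_eq_succ_of_ne_zero (by rintro rfl; simp at hl)
      have := hμ _ _ _ h2
      rw [mul_comm c] at this hsum
      exact ⟨s, x + (x' + z'), by linarith, by omega, v, hv, a, _, x, _, p, h1.append h3,
        by omega, by ring⟩
  obtain ⟨s, w', hw, hs, h'⟩ := key
  have := h'.extend hcyc s
  have e : t + c - (s + 1) * c + s * c = t := by
    have : (s + 1) * c = s * c + c := by ring
    omega
  rw [e] at this
  refine ⟨_, ?_, this⟩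
  push_cast at hw ⊢
  linarith

/-- Route through a fixed vertex of `C` and pad with loops. The residues of t - T mod c give
finitely many base walks; critical cycles supply the remaining length. -/
theorem exists_through_le [Fintype V] (hc : 0 < c) (hcyc : ∀ v ∈ C, Walk A c v v (μ * c))
    (hne : C.Nonempty) (hdiag : ∀ i, A i i ≠ ⊥)
    (hconn : ∀ i j, Relation.ReflTransGen (fun i j => A i j ≠ ⊥) i j) :
    ∃ (T : ℕ) (M : ℝ), ∀ t ≥ T, ∀ i j, ∃ w, M + μ * t ≤ w ∧ Through A C t i j w := by
  obtain ⟨v, hv⟩ := hne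
  choose f g hf using fun i j : V => exists_of_reflTransGen (hconn i j)
  set T := ∑ i, f i v + ∑ j, f v j with hT
  have hex : ∀ (s : ℕ) (i j : V), ∃ w, Through A C (T + s) i j w := by
    intro s i j
    have h1 : f i v ≤ ∑ i, f i v := Finset.single_le_sum (f := fun i => f i v) (by simp) (by simp)
    obtain ⟨y, hy⟩ := exists_prolong hdiag (hf v j) (T + s - f i v - f v j)
    have h2 : f v j ≤ ∑ j, f v j := Finset.single_le_sum (f := fun j => f v j) (by simp) (by simp)
    exact ⟨_, v, hv, _, _, _, _, hf i v, hy, by omega, rfl⟩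
  choose W hW using hex
  obtain ⟨M, hM⟩ := (Set.finite_range fun q : Fin c × V × V =>
    W q.1 q.2.1 q.2.2 - μ * (T + q.1 : ℕ)).bddBelow
  refine ⟨T, M, fun t ht i j => ?_⟩
  have h := (hW ((t - T) % c) i j).extend hcyc ((t - T) / c)
  have hb := hM ⟨(⟨(t - T) % c, Nat.mod_lt _ hc⟩, i, j), rfl⟩
  simp only at hb
  have e : t = T + (t - T) % c + (t - T) / c * c := by
    have := Nat.mod_add_div' (t - T) c
    omega
  rw [← e] at h
  refine ⟨_, ?_, h⟩
  have e' : (t : ℝ) = (T + (t - T) % c : ℕ) + ((t - T) / c * c : ℕ) := by exact_mod_cast e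
  rw [e', mul_add]
  linarith

end Critical

/-- The cyclicity theorem for weighted digraphs that are strongly connected and have loops. -/
theorem exists_cyclicity [Fintype V] [Nonempty V] (hdiag : ∀ i, A i i ≠ ⊥)
    (hconn : ∀ i j, Relation.ReflTransGen (fun i j => A i j ≠ ⊥) i j) :
    ∃ (μ : ℝ) (c N : ℕ), 0 < c ∧ (∀ i l w, Walk A l i i w → w ≤ μ * l) ∧ ∀ t ≥ N, ∀ i j w,
      (Walk A t i j w → ∃ w', w + μ * c ≤ w' ∧ Walk A (t + c) i j w') ∧
      (Walk A (t + c) i j w → ∃ w', w ≤ w' + μ * c ∧ Walk A t i j w') := by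
  classical
  obtain ⟨μ, hatt, hμ⟩ := exists_max_mean (A := A) (by
    obtain ⟨i⟩ := ‹Nonempty V›
    obtain ⟨a, ha⟩ := WithBot.ne_bot_iff_exists.1 (hdiag i)
    exact ⟨i, 1, a, one_pos, single ha.symm⟩)
  set C : Set V := {v | ∃ l, 0 < l ∧ Walk A l v v (μ * l)} with hC
  have hne : C.Nonempty := hatt
  obtain ⟨c, hc, hcyc⟩ : ∃ c, 0 < c ∧ ∀ v ∈ C, Walk A c v v (μ * c) := by
    have : ∀ v, ∃ l, 0 < l ∧ (v ∈ C → Walk A l v v (μ * l)) := fun v => by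
      by_cases hv : v ∈ C
      · obtain ⟨l, hl, p⟩ := hv
        exact ⟨l, hl, fun _ => p⟩
      · exact ⟨1, one_pos, fun h => absurd h hv⟩
    choose l hl hcl using this
    refine ⟨∏ v, l v, Finset.prod_pos fun v _ => hl v, fun v hv => ?_⟩
    obtain ⟨r, hr⟩ := Finset.dvd_prod_of_mem l (Finset.mem_univ v)
    exact ((hcl v hv).repeat_closed r).of_eq (by rw [hr, mul_comm]) (by rw [hr]; push_cast; ring)
  obtain ⟨T, M, hT⟩ := exists_through_le hc hcyc hne hdiag hconn
  -- A closed walk of mean μ has its base point in `C`, so cycles avoiding `C` have smaller mean; if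
  -- there are none, any ν < μ serves.
  obtain ⟨ν, hνμ, hν⟩ : ∃ ν < μ, ∀ i l w, Walk (avoid A C) l i i w → w ≤ ν * l := by
    by_cases hex : ∃ i l w, 0 < l ∧ Walk (avoid A C) l i i w
    · obtain ⟨ν, ⟨i, l, hl, p⟩, hν⟩ := exists_max_mean hex
      refine ⟨ν, lt_of_not_ge fun hle => p.notMem_of_avoid hl ?_, hν⟩
      have h0 : (0 : ℝ) < l := by positivity
      have h1 : ν * l = μ * l :=
        le_antisymm (hμ _ _ _ p.of_avoid) (mul_le_mul_of_nonneg_right hle h0.le)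
      exact ⟨l, hl, h1 ▸ p.of_avoid⟩
    · refine ⟨μ - 1, by linarith, fun i l w p => ?_⟩
      rcases Nat.eq_zero_or_pos l with rfl | hl
      · simp [p.weight_eq_zero]
      · exact absurd ⟨i, l, w, hl, p⟩ hex
  obtain ⟨M', hM'⟩ := exists_weight_le hν
  -- From T' on, M' + νt ≤ M + μt.
  obtain ⟨T', hT'⟩ := exists_nat_ge ((M' - M) / (μ - ν))
  have hdom : ∀ t, T ≤ t → T' ≤ t → ∀ i j w, Walk A t i j w →
      ∃ w', w ≤ w' ∧ Through A C t i j w' := by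
    intro t h1 h2 i j w p
    rcases p.through_or_avoid C with h | h
    · exact ⟨w, le_rfl, h⟩
    · obtain ⟨w', hw', q⟩ := hT t h1 i j
      refine ⟨w', ?_, q⟩
      have e1 := hM' _ _ _ _ h
      have e2 : (M' - M) / (μ - ν) ≤ t := hT'.trans (by exact_mod_cast h2)
      rw [div_le_iff₀ (by linarith)] at e2
      linarith
  refine ⟨μ, c, T + T' + 2 * (Fintype.card V * c), hc, hμ, fun t ht i j w => ⟨fun p => ?_,
    fun p => ?_⟩⟩
  · obtain ⟨w', hw', q⟩ := hdom t (by omega) (by omega) _ _ _ p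
    have := q.extend hcyc 1
    rw [one_mul] at this
    exact ⟨_, by linarith, this.walk⟩
  · obtain ⟨w', hw', q⟩ := hdom (t + c) (by omega) (by omega) _ _ _ p
    obtain ⟨z, hz, q'⟩ := q.shorten hc hcyc hμ (by omega)
    exact ⟨z, by linarith, q'.walk⟩

end Walk


/-! ### Max-plus linear algebra and orbits -/

theorem add_sup_univ {ι : Type*} [Fintype ι] (a : Re) (f : ι → Re) :
    a + Finset.univ.sup f = Finset.univ.sup fun i => a + f i :=
  Finset.apply_sup_eq_sup_comp_of_linearOrder (a + ·) (fun _ _ h => add_le_add le_rfl h)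
    (WithBot.add_bot a)

theorem sup_univ_add {ι : Type*} [Fintype ι] (a : Re) (f : ι → Re) :
    Finset.univ.sup f + a = Finset.univ.sup fun i => f i + a := by
  simp_rw [add_comm _ a, add_sup_univ]

variable {n : ℕ}

/-- The max-plus product of two square matrices. -/
def mulMat (A B : Matrix (Fin n) (Fin n) Re) : Matrix (Fin n) (Fin n) Re :=
  fun i j => Finset.univ.sup fun l => A i l + B l j

/-- The max-plus unit matrix. -/
def unitMat (n : ℕ) : Matrix (Fin n) (Fin n) Re :=
  fun i j => if i = j then 0 else ⊥

theorem le_mulVec (A : Matrix (Fin n) (Fin n) Re) (x : Fin n → Re) (i j : Fin n) :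
    A i j + x j ≤ mulVec A x i :=
  Finset.le_sup (f := fun j => A i j + x j) (Finset.mem_univ j)

theorem exists_mulVec_eq (A : Matrix (Fin n) (Fin n) Re) (x : Fin n → Re) (i : Fin n) :
    ∃ j, mulVec A x i = A i j + x j := by
  obtain ⟨j, -, hj⟩ := Finset.exists_mem_eq_sup Finset.univ ⟨i, Finset.mem_univ i⟩
    fun j => A i j + x j
  exact ⟨j, hj⟩

theorem le_mulMat (A B : Matrix (Fin n) (Fin n) Re) (i l j : Fin n) :
    A i l + B l j ≤ mulMat A B i j :=
  Finset.le_sup (f := fun l => A i l + B l j) (Finset.mem_univ l)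

theorem mulVec_mulMat (A B : Matrix (Fin n) (Fin n) Re) (x : Fin n → Re) :
    mulVec (mulMat A B) x = mulVec A (mulVec B x) := by
  funext i
  simp only [mulVec, mulMat, add_sup_univ, sup_univ_add, add_assoc]
  exact Finset.sup_comm _ _ _

theorem mulVec_unitMat (x : Fin n → Re) : mulVec (unitMat n) x = x := by
  funext i
  refine le_antisymm (Finset.sup_le fun j _ => ?_) ?_
  · by_cases h : i = j
    · simp [unitMat, h]
    · simp [unitMat, h]
  · simpa [unitMat] using le_mulVec (unitMat n) x i i

theorem mulVec_scale (A : Matrix (Fin n) (Fin n) Re) (c : Re) (x : Fin n → Re) :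
    mulVec A (scale c x) = scale c (mulVec A x) := by
  funext i
  simp only [mulVec, scale, add_sup_univ]
  exact congrArg _ (funext fun j => add_left_comm _ _ _)

theorem Irred.reflTransGen {A : Matrix (Fin n) (Fin n) Re} (h : Irred A) (i j : Fin n) :
    Relation.ReflTransGen (fun i j => A i j ≠ ⊥) i j := by
  obtain ⟨q, p, -, rfl, rfl, hp⟩ := h i j
  have hs : ∀ s : Fin q, A (p s.castSucc) (p s.succ) ≠ ⊥ := fun s hs => by
    rw [← Finset.add_sum_erase _ _ (Finset.mem_univ s), hs, WithBot.bot_add] at hp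
    exact lt_irrefl _ hp
  have : ∀ s : Fin (q + 1), Relation.ReflTransGen (fun i j => A i j ≠ ⊥) (p 0) (p s) := by
    intro s
    induction s using Fin.induction with
    | zero => exact .refl
    | succ s ih => exact ih.tail (hs s)
  exact this _

/-- The product `D (t-1) ⊗ ⋯ ⊗ D 0`. -/
def prodMat (D : ℕ → Matrix (Fin n) (Fin n) Re) : ℕ → Matrix (Fin n) (Fin n) Re
  | 0 => unitMat n
  | t + 1 => mulMat (D t) (prodMat D t)

section ProdMat

variable {D : ℕ → Matrix (Fin n) (Fin n) Re}

theorem sum_diag_le_prodMat (i : Fin n) (t : ℕ) :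
    ∑ s ∈ Finset.range t, D s i i ≤ prodMat D t i i := by
  induction t with
  | zero => simp [prodMat, unitMat]
  | succ t ih =>
    rw [Finset.sum_range_succ, add_comm]
    exact (add_le_add le_rfl ih).trans (le_mulMat _ _ i i i)

theorem prodMat_ne_bot (hdiag : ∀ t a, D t a a ≠ ⊥) {i j : Fin n} (h : D 0 i j ≠ ⊥) (t : ℕ) :
    prodMat D (t + 1) i j ≠ ⊥ := by
  induction t with
  | zero =>
    refine ne_bot_of_le_ne_bot ?_ (le_mulMat _ _ i j j)
    simpa [prodMat, unitMat] using h
  | succ t ih =>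
    exact ne_bot_of_le_ne_bot (WithBot.add_ne_bot.2 ⟨hdiag _ i, ih⟩) (le_mulMat _ _ i i j)

theorem eq_mulVec_prodMat {K : ℕ} (hD : ∀ t, D (t % K) = D t) {X : ℕ → Fin n → Re}
    (hX : ∀ t, X (t + 1) = mulVec (D t) (X t)) (s t : ℕ) :
    X (s * K + t) = mulVec (prodMat D t) (X (s * K)) := by
  induction t with
  | zero => simp [prodMat, mulVec_unitMat]
  | succ t ih =>
    rw [prodMat, mulVec_mulMat, ← ih, ← add_assoc, hX, ← hD, Nat.mul_add_mod', hD]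

end ProdMat

section Orbit

variable {B : Matrix (Fin n) (Fin n) Re} {Y : ℕ → Fin n → Re}

/-- With `exists_walk_eq`, this makes `Y t i` a maximum over walks, so thresholds for walks hold for
all initial vectors at once. -/
theorem Walk.add_le (hY : ∀ s, Y (s + 1) = mulVec B (Y s)) {t : ℕ} {i j : Fin n} {w : ℝ}
    (p : Walk B t i j w) : (w : Re) + Y 0 j ≤ Y t i := by
  induction p with
  | nil i => simp
  | cons h p ih =>
    rw [hY, WithBot.coe_add, ← h, add_assoc]
    exact (add_le_add le_rfl ih).trans (le_mulVec _ _ _ _)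

theorem exists_walk_eq (hY : ∀ s, Y (s + 1) = mulVec B (Y s)) (t : ℕ) (i : Fin n)
    (h : Y t i ≠ ⊥) : ∃ j w, Walk B t i j w ∧ Y t i = (w : Re) + Y 0 j := by
  induction t generalizing i with
  | zero => exact ⟨i, 0, .nil i, by simp⟩
  | succ t ih =>
    rw [hY] at h ⊢
    obtain ⟨l, hl⟩ := exists_mulVec_eq B (Y t) i
    rw [hl] at h ⊢
    obtain ⟨h1, h2⟩ := WithBot.add_ne_bot.1 h
    obtain ⟨j, w, p, hw⟩ := ih l h2
    obtain ⟨a, ha⟩ := WithBot.ne_bot_iff_exists.1 h1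
    exact ⟨j, a + w, .cons ha.symm p, by rw [hw, ← ha, WithBot.coe_add, add_assoc]⟩

/-- The max-plus cyclicity theorem for the orbits of an irreducible matrix with finite diagonal. -/
theorem exists_orbit_periodic (hn : 0 < n) (hdiag : ∀ i, B i i ≠ ⊥)
    (hconn : ∀ i j, Relation.ReflTransGen (fun i j => B i j ≠ ⊥) i j) :
    ∃ (μ : ℝ) (c N : ℕ), 0 < c ∧ (∀ i, B i i ≤ (μ : Re)) ∧
      ∀ Y : ℕ → Fin n → Re, (∀ s, Y (s + 1) = mulVec B (Y s)) →
        ∀ s ≥ N, Y (s + c) = scale ((μ * c : ℝ) : Re) (Y s) := by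
  have : Nonempty (Fin n) := ⟨⟨0, hn⟩⟩
  obtain ⟨μ, c, N, hc, hμ, h⟩ := Walk.exists_cyclicity hdiag hconn
  refine ⟨μ, c, N, hc, fun i => ?_, fun Y hY s hs => funext fun i => le_antisymm ?_ ?_⟩
  · obtain ⟨a, ha⟩ := WithBot.ne_bot_iff_exists.1 (hdiag i)
    have := hμ i 1 a (.single ha.symm)
    rw [← ha]
    exact WithBot.coe_le_coe.2 (by simpa using this)
  · by_cases hb : Y (s + c) i = ⊥
    · simp [hb]
    obtain ⟨j, w, p, hw⟩ := exists_walk_eq hY _ i hb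
    obtain ⟨w', hw', q⟩ := (h s hs i j w).2 p
    have hle : (w : Re) ≤ ((μ * c : ℝ) : Re) + (w' : Re) := by
      rw [← WithBot.coe_add]
      exact WithBot.coe_le_coe.2 (by linarith)
    rw [hw, scale]
    refine (add_le_add hle le_rfl).trans ?_
    rw [add_assoc]
    exact add_le_add le_rfl (q.add_le hY)
  · by_cases hb : Y s i = ⊥
    · simp [scale, hb]
    obtain ⟨j, w, p, hw⟩ := exists_walk_eq hY _ i hb
    obtain ⟨w', hw', q⟩ := (h s hs i j w).1 p
    have hle : ((μ * c : ℝ) : Re) + (w : Re) ≤ (w' : Re) := by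
      rw [← WithBot.coe_add]
      exact WithBot.coe_le_coe.2 (by linarith)
    rw [scale, hw, ← add_assoc]
    exact (add_le_add hle le_rfl).trans (q.add_le hY)

end Orbit

end MaxPlus

/-! ### The switched system -/

theorem theorem4 {m n : ℕ} [NeZero m]
    (A : Fin m → Matrix (Fin n) (Fin n) MaxPlus.Re)
    (hirr : ∀ i, MaxPlus.Irred (A i))
    (hdiag : ∀ i a, A i a a ≠ ⊥)
    (k : Fin m → ℕ) (hk : StrictMono k) :
    ∃ (lam : ℝ) (d k₀ : ℕ), 0 < d ∧ 0 < k₀ ∧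
      (∀ X : ℕ → Fin n → MaxPlus.Re, MaxPlus.IsTrajectory A k X →
        ∀ t ≥ k₀, X (t + d) = MaxPlus.scale (MaxPlus.pow (lam : MaxPlus.Re) d) (X t)) ∧
      ((∀ i a, 0 < A i a a) → 0 < lam) := by
  open MaxPlus in
  rcases Nat.eq_zero_or_pos n with rfl | hn
  · exact ⟨1, 1, 1, one_pos, one_pos, fun X _ t _ => funext fun i => i.elim0,
      fun _ => one_pos⟩
  obtain ⟨r, hr⟩ : ∃ r, period k = r + 1 := ⟨_, rfl⟩
  set K := period k with hK
  choose mode hmode using fun t => (existsUnique_active k t).exists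
  set D : ℕ → Matrix (Fin n) (Fin n) Re := fun t => A (mode t) with hD
  have hDper : ∀ t, D (t % K) = D t := fun t => by
    have h := hmode (t % K)
    simp only [Active, ← hK, Nat.mod_mod] at h
    exact congrArg A ((existsUnique_active k t).unique h (hmode t))
  have hDdiag : ∀ t a, D t a a ≠ ⊥ := fun t => hdiag _
  obtain ⟨μ, c, N, hc, hμ, hper⟩ := exists_orbit_periodic (B := prodMat D K) hn
    (fun i => by rw [hr]; exact prodMat_ne_bot hDdiag (hDdiag 0 i) r)
    (fun i j => by
      rw [hr]
      exact Relation.ReflTransGen.mono (fun _ _ h => prodMat_ne_bot hDdiag h r) _ _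
        ((hirr (mode 0)).reflTransGen i j))
  have hK0 : 0 < K := by omega
  -- Scaling by μc takes c periods, that is c * K steps; the `+ 1` only makes `k₀` positive.
  refine ⟨μ / K, c * K, N * K + 1, Nat.mul_pos hc hK0, by omega, fun X hX t ht => ?_,
    fun hpos => ?_⟩
  · have hX' : ∀ t, X (t + 1) = mulVec (D t) (X t) := fun t => hX t _ (hmode t)
    have hs : N ≤ t / K := (Nat.le_div_iff_mul_le hK0).2 (by omega)
    have h := hper (fun s => X (s * K))
      (fun s => by rw [add_mul, one_mul]; exact eq_mulVec_prodMat hDper hX' s K) _ hs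
    have e : t + c * K = (t / K + c) * K + t % K := by
      rw [add_mul]
      have := Nat.div_add_mod' t K
      omega
    have e' : X t = mulVec (prodMat D (t % K)) (X (t / K * K)) := by
      rw [← eq_mulVec_prodMat hDper hX', Nat.div_add_mod']
    have hpow : MaxPlus.pow ((μ / K : ℝ) : Re) (c * K) = ((μ * c : ℝ) : Re) := by
      have : (K : ℝ) ≠ 0 := by positivity
      rw [MaxPlus.pow, ← WithBot.coe_nsmul, nsmul_eq_mul]
      congr 1
      push_cast
      field_simp
    rw [e, eq_mulVec_prodMat hDper hX', h, mulVec_scale, ← e', hpow]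
  · have hsum : ∀ r, 0 < ∑ s ∈ Finset.range (r + 1), D s ⟨0, hn⟩ ⟨0, hn⟩ := by
      intro r
      induction r with
      | zero => simpa using hpos _ _
      | succ r ih =>
        rw [Finset.sum_range_succ]
        exact ih.trans_le (le_add_of_nonneg_right (hpos _ _).le)
    -- A diagonal entry of B is a cycle mean, so it is at most μ; it is at least the sum of the
    -- diagonal entries over a period.
    have h : (0 : Re) < (μ : Re) :=
      (hr ▸ hsum r).trans_le ((sum_diag_le_prodMat _ _).trans (hμ ⟨0, hn⟩))
    exact div_pos (WithBot.coe_lt_coe.1 h) (by exact_mod_cast hK0)
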